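/- Let $S_0=1$ and $S_k=S_{k-1}+S_{\max\{0,k-5\}}$ for $k\ge 1$. For $N\in\mathbb N_0$ let $\langle N\rangle=x_0x_1x_2\cdots$ be the digit sequence with $N=\sum_{i\ge0}x_iS_i$ obtained by the greedy algorithm (repeatedly subtract the largest $S_k$ not exceeding the current remainder). Let $X$ be the closure of $\{\langle N\rangle : N\in\mathbb N_0\}$ in the product topology on $\mathbb N_0^{\mathbb N_0}$. Then the map $\langle n\rangle\mapsto\langle n+1\rangle$ extends (necessarily uniquely) to a continuous map $T:X\to X$, there is exactly one $T$-invariant Borel probability measure $\mu$ on $X$, and $(X,T,\mu)$ is not measure-theoretically rigid: there is no sequence of positive integers $t_n\to\infty$ such that $\mu(T^{-t_n}(A)\,\triangle\,A)\to0$ for every Borel set $A\subseteq X$. -/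

import Mathlib

open Filter Topology MeasureTheory

/-- A kneading map: `Q k < k` for every `k ≥ 1` (the value at `0` plays no role). -/
structure KneadingMap where
  toFun : ℕ → ℕ
  lt' : ∀ k, 1 ≤ k → toFun k < k

namespace KneadingMap

/-- The cutting times `S 0 = 1`, `S k = S (k - 1) + S (Q k)` for `k ≥ 1`. -/
def S (Q : KneadingMap) : ℕ → ℕ
  | 0 => 1
  | k + 1 => S Q k + S Q (Q.toFun (k + 1))
termination_by k => k
decreasing_by
  · exact Nat.lt_succ_self k
  · exact Q.lt' (k + 1) (Nat.le_add_left 1 k)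

theorem S_pos (Q : KneadingMap) (k : ℕ) : 0 < Q.S k := by
  induction k with
  | zero => rw [S]; exact Nat.one_pos
  | succ k ih => rw [S]; exact Nat.add_pos_left ih _

/-- The largest `k` with `S k ≤ N`, for `N ≥ 1`. Since `S k ≥ k + 1`, searching `k ≤ N` suffices. -/
def top (Q : KneadingMap) (N : ℕ) : ℕ := Nat.findGreatest (fun k => Q.S k ≤ N) N

/-- The greedy expansion `⟨N⟩ = x₀x₁x₂…` of `N = ∑ xᵢ S i`: subtract the largest `S k ≤ N`,
count it in the digit at position `k`, and go on with the remainder. -/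
def digits (Q : KneadingMap) (N : ℕ) : ℕ → ℕ :=
  if h : N = 0 then 0
  else digits Q (N - Q.S (Q.top N)) + Pi.single (Q.top N) 1
termination_by N
decreasing_by exact Nat.sub_lt (Nat.pos_of_ne_zero h) (Q.S_pos _)

/-- The space `X`: the closure of `{⟨N⟩ : N ∈ ℕ₀}` in the product topology of `ℕ₀^ℕ₀`. -/
def X (Q : KneadingMap) : Set (ℕ → ℕ) := closure (Set.range Q.digits)

/-- The expansion `⟨N⟩` as a point of `X`. -/
def expansion (Q : KneadingMap) (N : ℕ) : Q.X :=
  ⟨Q.digits N, subset_closure (Set.mem_range_self N)⟩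

instance (Q : KneadingMap) : Nonempty Q.X := ⟨Q.expansion 0⟩

/-- The addition of one `⟨n⟩ ↦ ⟨n + 1⟩`, extended to `X` by
`T x = lim ⟨n + 1⟩` as `⟨n⟩ → x`. -/
noncomputable def T (Q : KneadingMap) (x : Q.X) : Q.X :=
  limUnder (comap Q.expansion (𝓝 x)) (fun n => Q.expansion (n + 1))

end KneadingMap

/-- `μ` is a `T`-invariant probability measure. -/
def IsInvariantProbability {X : Type*} [MeasurableSpace X] (T : X → X) (μ : Measure X) : Prop :=
  IsProbabilityMeasure μ ∧ MeasurePreserving T μ μ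

/-- Measure-theoretical rigidity of `(X, T, μ)`: there is a sequence `t n → ∞` such that
`μ (T^{-t n} A ∆ A) → 0` for all measurable sets `A`. -/
def IsMeasureRigid {X : Type*} [MeasurableSpace X] (T : X → X) (μ : Measure X) : Prop :=
  ∃ t : ℕ → ℕ, Tendsto t atTop atTop ∧ ∀ A : Set X, MeasurableSet A →
    Tendsto (fun n => μ (symmDiff (T^[t n] ⁻¹' A) A)) atTop (𝓝 0)

/-- The kneading map `Q k = max {0, k - 5}` (truncated subtraction). -/
def kneadingFive : KneadingMap where
  toFun k := k - 5
  lt' := by intro k hk; omega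

/-! The polynomial x^5 - x^4 - 1 of the recursion factors as (x^2 - x + 1)(x^3 - x - 1). Hence d k =
S (k + 3) - S (k + 1) - S k (`defect`) satisfies d (k + 2) = d (k + 1) - d k; it stays in {-1, 0, 1}
and never vanishes twice in a row. So for at least one of any two consecutive j, the sum S (j + 1) +
S j misses the cutting time S (j + 3) by exactly one unit.

This prevents rigidity. Let t be large with leading term S K. For some k near K and all N in a
window of length S (K - 15), adding s = S k leaves the low digits of N alone, while in N + t it
merges with the leading term and moves the remainder by one (`exists_carry`,
`exists_distinguishing_shift`). So for the corresponding points x, not both x and T^s x return to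
their lowest five digits after time t. The window has a proportion bounded below independently of t,
and invariance of μ bounds the measure of the non-returning set below for all large t.

For unique ergodicity, adding one either raises the number formed by the lowest K digits by one, or
resets it to 0 from S j - 1 with K - 4 ≤ j ≤ K (`val_succ`). Cylinder measures are therefore
nonincreasing in that number and drop only at those places, so summation by parts traps every
invariant measure between the extreme frequencies on the intervals [0, S j). These frequencies are
quotients of two solutions of one recursion, and they converge (`recurrence_bounds`). The same
description of adding one gives continuity of T (`val_succ_congr`), and compactness then gives an
invariant measure. -/

/-- **Krylov–Bogoliubov**: a continuous self-map of a compact metrizable space preserves a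
probability measure. -/
theorem exists_isInvariantProbability {E : Type*} [TopologicalSpace E] [CompactSpace E]
    [TopologicalSpace.MetrizableSpace E] [MeasurableSpace E] [BorelSpace E] [Nonempty E]
    {T : E → E} (hT : Continuous T) : ∃ μ : Measure E, IsInvariantProbability T μ := by
  obtain ⟨x⟩ := ‹Nonempty E›
  let m : ℕ → Measure E := fun n =>
    ((n : ENNReal) + 1)⁻¹ • ∑ i ∈ Finset.range (n + 1), Measure.dirac (T^[i] x)
  have hm : ∀ n, IsProbabilityMeasure (m n) := fun n => ⟨by
    simp only [m, Measure.smul_apply, Measure.finsetSum_apply, measure_univ, smul_eq_mul,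
      Finset.sum_const, Finset.card_range, nsmul_eq_mul, mul_one]
    push_cast
    exact ENNReal.inv_mul_cancel (by simp) (by simp)⟩
  have hint : ∀ (n : ℕ) (f : C(E, ℝ)), ∫ y, f y ∂m n =
      ((n : ℝ) + 1)⁻¹ * ∑ i ∈ Finset.range (n + 1), f (T^[i] x) := by
    intro n f
    rw [integral_smul_measure, integral_finsetSum_measure fun i _ => by
      exact (integrable_dirac (by simp))]
    simp [ENNReal.toReal_add]
  let P : ℕ → ProbabilityMeasure E := fun n => ⟨m n, hm n⟩
  obtain ⟨ν, -, hν⟩ := isCompact_univ.exists_clusterPt (f := map P atTop) (by simp)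
  obtain ⟨U, hU, hUν⟩ := mapClusterPt_iff_ultrafilter.1 hν
  refine ⟨ν, inferInstance, hT.measurable, ?_⟩
  have := Measure.isProbabilityMeasure_map (μ := (ν : Measure E)) hT.aemeasurable
  refine ext_of_forall_integral_eq_of_IsFiniteMeasure fun f => ?_
  rw [integral_map hT.aemeasurable f.continuous.aestronglyMeasurable]
  rw [ProbabilityMeasure.tendsto_iff_forall_integral_tendsto] at hUν
  have h₁ := hUν f
  have h₂ := hUν (f.compContinuous ⟨T, hT⟩)
  -- The orbit sums telescope, so composing f with T changes the nth average by O(1 / n).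
  have h₃ : Tendsto (fun n => ∫ y, f.compContinuous ⟨T, hT⟩ y ∂m n - ∫ y, f y ∂m n) atTop (𝓝 0) := by
    have hdiff : ∀ n : ℕ, ∫ y, f.compContinuous ⟨T, hT⟩ y ∂m n - ∫ y, f y ∂m n =
        ((n : ℝ) + 1)⁻¹ * (f (T^[n + 1] x) - f x) := by
      intro n
      have e₁ := hint n (f.compContinuous ⟨T, hT⟩).toContinuousMap
      have e₂ := hint n f.toContinuousMap
      simp only [BoundedContinuousFunction.coe_toContinuousMap,
        BoundedContinuousFunction.compContinuous_apply, ContinuousMap.coe_mk] at e₁ e₂ ⊢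
      rw [e₁, e₂, ← mul_sub, ← Finset.sum_sub_distrib]
      simp only [← Function.iterate_succ_apply']
      rw [Finset.sum_range_sub (fun i => f (T^[i] x))]
      rfl
    simp only [hdiff]
    refine squeeze_zero_norm (a := fun n : ℕ => 1 / ((n : ℝ) + 1) * (‖f‖ + ‖f‖)) (fun n => ?_) ?_
    · rw [norm_mul, norm_inv, one_div, Real.norm_of_nonneg (show (0 : ℝ) ≤ n + 1 by positivity)]
      gcongr
      exact (norm_sub_le _ _).trans (add_le_add (f.norm_coe_le_norm _) (f.norm_coe_le_norm _))
    · simpa using tendsto_one_div_add_atTop_nhds_zero_nat.mul_const (‖f‖ + ‖f‖)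
  have h₄ := tendsto_nhds_unique (h₃.mono_left hU) (h₂.sub h₁)
  exact sub_eq_zero.1 h₄.symm

namespace KneadingFive

local notation "𝐒" => KneadingMap.S kneadingFive
local notation "𝐃" => KneadingMap.digits kneadingFive
local notation "𝐗" => KneadingMap.X kneadingFive
local notation "𝐓" => KneadingMap.T kneadingFive

/-! ### Cutting times and greedy expansions -/

theorem S_zero : 𝐒 0 = 1 := by rw [KneadingMap.S]

theorem S_succ (k : ℕ) : 𝐒 (k + 1) = 𝐒 k + 𝐒 (k - 4) := by
  rw [KneadingMap.S]
  rfl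

theorem S_pos (k : ℕ) : 0 < 𝐒 k := KneadingMap.S_pos _ k

theorem S_strictMono : StrictMono 𝐒 :=
  strictMono_nat_of_lt_succ fun k => by
    have := S_pos (k - 4)
    rw [S_succ]
    omega

theorem S_mono {i j : ℕ} (h : i ≤ j) : 𝐒 i ≤ 𝐒 j := S_strictMono.monotone h

theorem S_lt {i j : ℕ} (h : i < j) : 𝐒 i < 𝐒 j := S_strictMono h

theorem lt_S (k : ℕ) : k < 𝐒 k := by
  induction k with
  | zero => exact S_pos 0
  | succ k ih =>
    have := S_pos (k - 4)
    rw [S_succ]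
    omega

theorem S_succ_le_two_mul (k : ℕ) : 𝐒 (k + 1) ≤ 2 * 𝐒 k := by
  have := S_mono (Nat.sub_le k 4)
  rw [S_succ]
  omega

theorem top_eq {k N : ℕ} (h₁ : 𝐒 k ≤ N) (h₂ : N < 𝐒 (k + 1)) : kneadingFive.top N = k := by
  unfold KneadingMap.top
  rw [Nat.findGreatest_eq_iff]
  refine ⟨by have := lt_S k; omega, fun _ => h₁, fun n hn _ h => ?_⟩
  have : 𝐒 (k + 1) ≤ 𝐒 n := S_mono hn
  omega

theorem digits_zero : 𝐃 0 = 0 := by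
  rw [KneadingMap.digits]
  simp

theorem digits_S_add {k R : ℕ} (h : R < 𝐒 (k - 4)) : 𝐃 (𝐒 k + R) = 𝐃 R + Pi.single k 1 := by
  have hk := S_pos k
  have ht : kneadingFive.top (𝐒 k + R) = k := top_eq (by omega) (by rw [S_succ]; omega)
  rw [KneadingMap.digits, dif_neg (by omega), ht]
  congr 2
  omega

theorem exists_S_add {N : ℕ} (h : N ≠ 0) : ∃ k R, R < 𝐒 (k - 4) ∧ N = 𝐒 k + R := by
  have hex : ∃ k, N < 𝐒 (k + 1) := ⟨N, by have := lt_S (N + 1); omega⟩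
  classical
  have h₁ := Nat.find_spec hex
  have h₂ : 𝐒 (Nat.find hex) ≤ N := by
    rcases hk : Nat.find hex with _ | k
    · rw [S_zero]; omega
    · have := Nat.find_min hex (m := k) (by omega)
      omega
  rw [S_succ] at h₁
  exact ⟨Nat.find hex, N - 𝐒 (Nat.find hex), by omega, by omega⟩

/-- Induction along the greedy algorithm. -/
theorem greedy_induction {P : ℕ → Prop} (zero : P 0)
    (add : ∀ k R, R < 𝐒 (k - 4) → P R → P (𝐒 k + R)) (N : ℕ) : P N := by
  induction N using Nat.strong_induction_on with
  | _ N ih =>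
    by_cases h : N = 0
    · exact h ▸ zero
    · obtain ⟨k, R, hR, rfl⟩ := exists_S_add h
      exact add k R hR (ih R (by have := S_pos k; omega))

theorem digits_eq_zero_of_lt {N k : ℕ} (h : N < 𝐒 k) {i : ℕ} (hi : k ≤ i) : 𝐃 N i = 0 := by
  induction N using greedy_induction with
  | zero => simp [digits_zero]
  | add j R hR ih =>
    have hj : j < k := S_strictMono.lt_iff_lt.1 (by omega)
    rw [digits_S_add hR, Pi.add_apply, ih (by omega), Pi.single_eq_of_ne (by omega), add_zero]

theorem digits_le_one (N i : ℕ) : 𝐃 N i ≤ 1 := by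
  induction N using greedy_induction with
  | zero => simp [digits_zero]
  | add k R hR ih =>
    rw [digits_S_add hR, Pi.add_apply]
    by_cases h : i = k
    · subst h
      rw [digits_eq_zero_of_lt hR (Nat.sub_le _ _)]
      simp
    · rw [Pi.single_eq_of_ne h]
      exact ih

/-! ### Addition without carries -/

/-- All digits of `U` below position `k` vanish. -/
def LowZero (k U : ℕ) : Prop := ∀ i < k, 𝐃 U i = 0

theorem lowZero_zero (k : ℕ) : LowZero k 0 := fun i _ => by simp [digits_zero]

theorem LowZero.of_S_add {j k R : ℕ} (hR : R < 𝐒 (k - 4)) (h : LowZero j (𝐒 k + R)) :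
    j ≤ k ∧ LowZero j R := by
  constructor
  · by_contra! hk
    have := h k hk
    simp [digits_S_add hR] at this
  · intro i hi
    have := h i hi
    rw [digits_S_add hR, Pi.add_apply] at this
    omega

theorem LowZero.S_add {j k R : ℕ} (hR : R < 𝐒 (k - 4)) (hk : j ≤ k) (h : LowZero j R) :
    LowZero j (𝐒 k + R) := fun i hi => by
  rw [digits_S_add hR, Pi.add_apply, h i hi, Pi.single_eq_of_ne (by omega), add_zero]

theorem lowZero_S {j k : ℕ} (hk : j ≤ k) : LowZero j (𝐒 k) :=
  LowZero.S_add (S_pos _) hk (lowZero_zero j)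

/-- If U has leading term S i, induction gives its remainder a distance of at least S (j - 4) from S
(i - 4), and S i + S (i - 4) = S (i + 1) ≤ S k. This room is what lets the greedy algorithm strip U
from U + R before touching R, in `digits_add`. -/
theorem LowZero.add_S_le {j U : ℕ} (h : LowZero j U) :
    ∀ {k : ℕ}, U < 𝐒 k → j ≤ k + 4 → U + 𝐒 (j - 4) ≤ 𝐒 k := by
  induction U using greedy_induction with
  | zero =>
    intro k _ hj
    have := S_mono (show j - 4 ≤ k by omega)
    omega
  | add i R hR ih =>
    intro k hk _
    obtain ⟨hi, hl⟩ := h.of_S_add hR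
    have h₁ := ih hl hR (by omega)
    have h₂ : i < k := S_strictMono.lt_iff_lt.1 (by omega)
    have h₃ := S_mono (Nat.succ_le_of_lt h₂)
    rw [Nat.succ_eq_add_one, S_succ] at h₃
    omega

theorem digits_add {j U R : ℕ} (hU : LowZero j U) (hR : R < 𝐒 (j - 4)) :
    𝐃 (U + R) = 𝐃 U + 𝐃 R := by
  induction U using greedy_induction with
  | zero => simp [digits_zero]
  | add k V hV ih =>
    obtain ⟨hk, hl⟩ := hU.of_S_add hV
    have := hl.add_S_le hV (by omega)
    rw [add_assoc, digits_S_add (show V + R < _ by omega), ih hl, digits_S_add hV]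
    abel

theorem exists_truncation (k N : ℕ) :
    ∃ U R, N = U + R ∧ LowZero k U ∧ R < 𝐒 k ∧ 𝐃 N = 𝐃 U + 𝐃 R := by
  induction N using greedy_induction with
  | zero => exact ⟨0, 0, rfl, lowZero_zero k, S_pos k, by simp [digits_zero]⟩
  | add i N hN ih =>
    obtain hi | hi := lt_or_ge i k
    · refine ⟨0, 𝐒 i + N, by simp, lowZero_zero k, ?_, by simp [digits_zero]⟩
      have := S_mono (Nat.succ_le_of_lt hi)
      rw [Nat.succ_eq_add_one, S_succ] at this
      omega
    · obtain ⟨U, R, rfl, hU, hR, hd⟩ := ih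
      refine ⟨𝐒 i + U, R, by ring, hU.S_add (by omega) hi, hR, ?_⟩
      rw [digits_S_add hN, hd, digits_S_add (by omega)]
      abel

/-! ### Truncated expansions and the addition of one -/

/-- The number with the digits `x 0, …, x (k - 1)`. -/
def val (k : ℕ) (x : ℕ → ℕ) : ℕ := ∑ i ∈ Finset.range k, x i * 𝐒 i

theorem val_congr {k : ℕ} {x y : ℕ → ℕ} (h : ∀ i < k, x i = y i) : val k x = val k y :=
  Finset.sum_congr rfl fun i hi => by rw [h i (Finset.mem_range.1 hi)]

theorem val_digits_of_lt {k N : ℕ} (h : N < 𝐒 k) : val k (𝐃 N) = N := by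
  induction N using greedy_induction with
  | zero => simp [digits_zero, val]
  | add j R hR ih =>
    have hj : j < k := S_strictMono.lt_iff_lt.1 (by omega)
    have ih' := ih (by omega)
    unfold val at ih' ⊢
    rw [digits_S_add hR]
    simp only [Pi.add_apply, add_mul, Finset.sum_add_distrib, ih']
    rw [Finset.sum_eq_single j (fun i _ hi => by simp [hi]) (by simp [hj])]
    simp [add_comm]

theorem val_lt_and_digits (k N : ℕ) :
    val k (𝐃 N) < 𝐒 k ∧ ∀ i < k, 𝐃 (val k (𝐃 N)) i = 𝐃 N i := by
  obtain ⟨U, R, rfl, hU, hR, hd⟩ := exists_truncation k N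
  have h : ∀ i < k, 𝐃 R i = 𝐃 (U + R) i := fun i hi => by
    rw [hd, Pi.add_apply, hU i hi, zero_add]
  rw [← val_congr h, val_digits_of_lt hR]
  exact ⟨hR, h⟩

theorem val_lt (k N : ℕ) : val k (𝐃 N) < 𝐒 k := (val_lt_and_digits k N).1

theorem digits_val (k N : ℕ) {i : ℕ} (hi : i < k) : 𝐃 (val k (𝐃 N)) i = 𝐃 N i :=
  (val_lt_and_digits k N).2 i hi

theorem digits_eq_of_val_eq {k M N : ℕ} (h : val k (𝐃 M) = val k (𝐃 N)) {i : ℕ} (hi : i < k) :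
    𝐃 M i = 𝐃 N i := by
  rw [← digits_val k M hi, h, digits_val k N hi]

theorem val_eq_of_val_eq {j k M N : ℕ} (h : val k (𝐃 M) = val k (𝐃 N)) (hj : j ≤ k) :
    val j (𝐃 M) = val j (𝐃 N) :=
  val_congr fun _ hi => digits_eq_of_val_eq h (by omega)

theorem LowZero.val_eq {k U : ℕ} (h : LowZero k U) : val k (𝐃 U) = 0 :=
  Finset.sum_eq_zero fun i hi => by rw [h i (Finset.mem_range.1 hi), zero_mul]

theorem exists_lowZero_add_val (k N : ℕ) : ∃ U, LowZero k U ∧ N = U + val k (𝐃 N) := by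
  obtain ⟨U, R, rfl, hU, hR, hd⟩ := exists_truncation k N
  refine ⟨U, hU, ?_⟩
  have h : ∀ i < k, 𝐃 R i = 𝐃 (U + R) i := fun i hi => by
    rw [hd, Pi.add_apply, hU i hi, zero_add]
  rw [← val_congr h, val_digits_of_lt hR]

theorem LowZero.val_add {j k U R : ℕ} (h : LowZero j U) (hR : R < 𝐒 (j - 4)) (hk : k ≤ j) :
    val k (𝐃 (U + R)) = val k (𝐃 R) :=
  val_congr fun i hi => by rw [digits_add h hR, Pi.add_apply, h i (by omega), zero_add]

theorem val_S_add {i k R : ℕ} (hR : R < 𝐒 (i - 4)) (hk : k ≤ i) :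
    val k (𝐃 (𝐒 i + R)) = val k (𝐃 R) :=
  (lowZero_S le_rfl).val_add hR hk

/-- The effect of adding one on the lowest `K` digits. -/
theorem val_succ (K N : ℕ) :
    (val K (𝐃 (N + 1)) = val K (𝐃 N) + 1) ∨
    (val K (𝐃 (N + 1)) = 0 ∧ ∃ j, K - 4 ≤ j ∧ j ≤ K ∧ val K (𝐃 N) + 1 = 𝐒 j) := by
  suffices h : (val K (𝐃 (N + 1)) = val K (𝐃 N) + 1) ∨
      (val K (𝐃 (N + 1)) = 0 ∧ ∃ j, K - 4 ≤ j ∧ val K (𝐃 N) + 1 = 𝐒 j) by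
    refine h.imp_right fun ⟨h₀, j, hj, h⟩ => ⟨h₀, j, hj, ?_, h⟩
    have := val_lt K N
    exact S_strictMono.le_iff_le.1 (by omega)
  have small : ∀ M < 𝐒 K, (val K (𝐃 (M + 1)) = val K (𝐃 M) + 1) ∨
      (val K (𝐃 (M + 1)) = 0 ∧ ∃ j, K - 4 ≤ j ∧ val K (𝐃 M) + 1 = 𝐒 j) := by
    intro M hM
    obtain h | h := lt_or_ge (M + 1) (𝐒 K)
    · left
      rw [val_digits_of_lt hM, val_digits_of_lt h]
    · right
      have h' : M + 1 = 𝐒 K := by omega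
      exact ⟨by rw [h', (lowZero_S le_rfl).val_eq], K, by omega, by rw [val_digits_of_lt hM, h']⟩
  induction N using greedy_induction with
  | zero => exact small 0 (S_pos K)
  | add i R hR ih =>
    obtain hi | hi := lt_or_ge i K
    · refine small _ ?_
      have := S_mono (Nat.succ_le_of_lt hi)
      rw [Nat.succ_eq_add_one, S_succ] at this
      omega
    · rw [val_S_add hR hi]
      obtain h | h := lt_or_ge (R + 1) (𝐒 (i - 4))
      · rwa [add_assoc, val_S_add h hi]
      -- The carry S i + S (i - 4) = S (i + 1) clears all digits below K. If the lowest K digits of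
      -- R advance without a reset, then i - 4 < K, and R + 1 = S (i - 4) is already its own
      -- truncation.
      · have hR' : R + 1 = 𝐒 (i - 4) := by omega
        right
        refine ⟨?_, ?_⟩
        · rw [add_assoc, hR', ← S_succ, (lowZero_S (by omega)).val_eq]
        · obtain h | ⟨-, h⟩ := ih
          · rw [← h, hR']
            obtain h' | h' := lt_or_ge (i - 4) K
            · exact ⟨i - 4, by omega, val_digits_of_lt (S_lt h')⟩
            · rw [hR', (lowZero_S h').val_eq] at h
              omega
          · exact h

/-- The lowest `k` digits of `N + 1` depend on the lowest `k + 5` digits of `N` only. -/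
theorem val_succ_congr {k M N : ℕ} (h : val (k + 5) (𝐃 M) = val (k + 5) (𝐃 N)) :
    val k (𝐃 (M + 1)) = val k (𝐃 (N + 1)) := by
  have aux : ∀ A, val (k + 5) (𝐃 (A + 1)) = 0 → val k (𝐃 (A + 1)) = 0 := by
    intro A hA
    have : val (k + 5) (𝐃 (A + 1)) = val (k + 5) (𝐃 0) := by rw [hA]; simp [digits_zero, val]
    rw [val_eq_of_val_eq this (by omega)]
    simp [digits_zero, val]
  -- For the mixed case: one side resets, the other advances to S j with j ≥ k + 1, whose digits
  -- below k vanish too.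
  have aux' : ∀ A j, k + 5 - 4 ≤ j → j ≤ k + 5 → val (k + 5) (𝐃 (A + 1)) = 𝐒 j →
      val k (𝐃 (A + 1)) = 0 := by
    intro A j hj hj' hA
    have hlt : 𝐒 j < 𝐒 (k + 5) := hA ▸ val_lt _ _
    have : val (k + 5) (𝐃 (A + 1)) = val (k + 5) (𝐃 (𝐒 j)) := by rw [hA, val_digits_of_lt hlt]
    rw [val_eq_of_val_eq this (by omega), (lowZero_S (by omega)).val_eq]
  obtain hM | ⟨hM, i, hi, hi', hMi⟩ := val_succ (k + 5) M <;>
    obtain hN | ⟨hN, j, hj, hj', hNj⟩ := val_succ (k + 5) N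
  · exact val_eq_of_val_eq (by rw [hM, hN, h]) (by omega)
  · rw [aux N hN, aux' M j hj hj' (by omega)]
  · rw [aux M hM, aux' N i hi hi' (by omega)]
  · rw [aux M hM, aux N hN]

/-! ### The defect and the carries it causes -/

/-- The defect of the recursion `a (k + 3) = a (k + 1) + a k` along the cutting times. -/
def defect (k : ℕ) : ℤ := (𝐒 (k + 3) : ℤ) - 𝐒 (k + 1) - 𝐒 k

/-- This is the factor x^2 - x + 1 of x^5 - x^4 - 1, left after x^3 - x - 1 has been applied to the
cutting times. -/
theorem defect_add_two (k : ℕ) : defect (k + 2) = defect (k + 1) - defect k := by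
  have h : ∀ i, (𝐒 (k + (i + 5)) : ℤ) = 𝐒 (k + (i + 4)) + 𝐒 (k + i) := fun i => by
    rw [← add_assoc, S_succ, Nat.add_sub_cancel]
    push_cast
    rfl
  have h0 := h 0
  simp only [Nat.reduceAdd, add_zero] at h0
  simp only [defect, add_assoc, Nat.reduceAdd]
  linarith

theorem defect_cases (k : ℕ) : |defect k| ≤ 1 ∧ (defect k ≠ 0 ∨ defect (k + 1) ≠ 0) := by
  have h0 : defect 0 = 1 := by simp [defect, S_succ, S_zero]
  have h1 : defect 1 = 0 := by simp [defect, S_succ, S_zero]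
  -- The form x^2 - xy + y^2 is invariant under (x, y) ↦ (y, y - x).
  have key : defect k ^ 2 - defect k * defect (k + 1) + defect (k + 1) ^ 2 = 1 := by
    induction k with
    | zero => simp [h0, h1]
    | succ k ih =>
      rw [add_assoc k 1 1, one_add_one_eq_two, defect_add_two]
      linarith
  constructor
  · rw [← sq_le_one_iff_abs_le_one]
    by_contra! h
    nlinarith [sq_nonneg (defect k - 2 * defect (k + 1))]
  · by_contra! h
    simp [h.1, h.2] at key

theorem val_five_succ_ne (u : ℕ) : val 5 (𝐃 (u + 1)) ≠ val 5 (𝐃 u) := by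
  obtain h | ⟨h, j, hj, -, h'⟩ := val_succ 5 u
  · omega
  · intro h''
    have := lt_S j
    omega

theorem two_mul_S_le (k : ℕ) : 2 * 𝐒 k ≤ 𝐒 (k + 5) := by
  have := S_mono (show k ≤ k + 4 by omega)
  rw [S_succ, show k + 4 - 4 = k by omega]
  omega

/-- Adding `𝐒 k` to `𝐒 K + u` carries, and shifts the lower digits by one unit. -/
theorem exists_carry (K : ℕ) (hK : 1 ≤ K) : ∃ k, K - 1 ≤ k ∧ k ≤ K + 1 ∧
    ∀ u, 1 ≤ u → u < 𝐒 (K - 4) →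
      ∃ i v, K ≤ i ∧ i ≤ K + 3 ∧ v < 𝐒 (i - 4) ∧ (v = u + 1 ∨ u = v + 1) ∧
        𝐒 K + u + 𝐒 k = 𝐒 i + v := by
  -- One of the defects at K - 1 and K is nonzero; this decides between S K + S (K - 1) and S (K +
  -- 1) + S K.
  have hj : ∃ j k, K - 1 ≤ k ∧ k ≤ K + 1 ∧ K ≤ j + 1 ∧ j ≤ K ∧ 𝐒 K + 𝐒 k = 𝐒 (j + 1) + 𝐒 j ∧
      defect j ≠ 0 := by
    obtain ⟨K, rfl⟩ := Nat.exists_eq_add_of_le' hK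
    obtain h | h := (defect_cases K).2
    · exact ⟨K, K, by omega, by omega, by omega, by omega, rfl, h⟩
    · exact ⟨K + 1, K + 2, by omega, by omega, by omega, by omega, add_comm _ _, h⟩
  obtain ⟨j, k, hk, hk', hj, hj', hS, hd⟩ := hj
  refine ⟨k, hk, hk', fun u hu hu' => ?_⟩
  have h₁ := (abs_le.1 (defect_cases j).1)
  have hK4 : 4 ≤ K := by
    by_contra! h
    rw [show K - 4 = 0 by omega, S_zero] at hu'
    omega
  have h₂ : 𝐒 (K - 4) < 𝐒 (j + 3 - 4) := S_lt (by omega)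
  unfold defect at h₁ hd
  -- The new remainder is u minus the defect; u ≥ 1 keeps it nonnegative when the defect is 1.
  by_cases h : (𝐒 (j + 3) : ℤ) - 𝐒 (j + 1) - 𝐒 j = 1
  · exact ⟨j + 3, u - 1, by omega, by omega, by omega, by omega, by omega⟩
  · exact ⟨j + 3, u + 1, by omega, by omega, by omega, by omega, by omega⟩

/-- For every large `t` there is `s` such that, for a proportion of the `N` bounded below, adding
`s` preserves the lowest five digits of `N` and changes those of `N + t`. -/
theorem exists_distinguishing_shift {t : ℕ} (ht : 𝐒 20 ≤ t) : ∃ K a s, 20 ≤ K ∧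
    ∀ N, a ≤ N → N < a + 𝐒 (K - 15) → N < 𝐒 (K + 10 - 4) ∧ ∀ U, LowZero (K + 10) U →
      val 5 (𝐃 (U + N + s)) = val 5 (𝐃 (U + N)) ∧
      val 5 (𝐃 (U + N + s + t)) ≠ val 5 (𝐃 (U + N + t)) := by
  obtain ⟨K, t', ht', rfl⟩ := exists_S_add (show t ≠ 0 by have := S_pos 20; omega)
  have hK : 20 ≤ K := by
    by_contra! h
    have h₁ : 𝐒 (K + 1) ≤ 𝐒 20 := S_mono h
    rw [S_succ] at h₁
    omega
  have hL := S_pos (K - 15)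
  -- Cutting times at least double over five indices. Both windows below end by 3 S (K - 15), hence
  -- below S (K - 5), so adding S k to N causes no carry.
  have h4L : 4 * 𝐒 (K - 15) ≤ 𝐒 (K - 5) := by
    have h₁ := two_mul_S_le (K - 15)
    have h₂ := two_mul_S_le (K - 15 + 5)
    rw [show K - 15 + 5 + 5 = K - 5 by omega] at h₂
    omega
  -- The window is placed so that N + t has the same leading term throughout: S K if t' + N stays
  -- below S (K - 4), and S (K + 1) = S K + S (K - 4) if it always exceeds that bound.
  have hM : ∃ M a, K ≤ M ∧ M ≤ K + 1 ∧ a + 𝐒 (K - 15) ≤ 𝐒 (K - 5) ∧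
      ∀ N, a ≤ N → N < a + 𝐒 (K - 15) →
        ∃ u, 1 ≤ u ∧ u < 𝐒 (M - 4) ∧ 𝐒 K + t' + N = 𝐒 M + u := by
    obtain h | h := le_or_gt (t' + 2 * 𝐒 (K - 15)) (𝐒 (K - 4))
    · exact ⟨K, 𝐒 (K - 15), le_rfl, by omega, by omega, fun N hN hN' =>
        ⟨t' + N, by omega, by omega, by omega⟩⟩
    · refine ⟨K + 1, 2 * 𝐒 (K - 15), by omega, le_rfl, by omega, fun N hN hN' =>
        ⟨t' + N - 𝐒 (K - 4), by omega, ?_, ?_⟩⟩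
      · have h₁ : 𝐒 (K - 5) ≤ 𝐒 (K + 1 - 4) := S_mono (by omega)
        omega
      · rw [S_succ]
        omega
  obtain ⟨M, a, hKM, hMK, ha, hM⟩ := hM
  obtain ⟨k, hk, hk', hc⟩ := exists_carry M (by omega)
  refine ⟨K, a, 𝐒 k, hK, fun N hN hN' => ?_⟩
  obtain ⟨u, hu, hu', huN⟩ := hM N hN hN'
  obtain ⟨i, v, hi, hi', hv, huv, hiv⟩ := hc u hu hu'
  have hNk : N < 𝐒 (k - 4) := by
    have : 𝐒 (K - 5) ≤ 𝐒 (k - 4) := S_mono (by omega)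
    omega
  -- All sums in play stay below S (K + 6), so the digits of U from position K + 10 on are never
  -- reached by a carry.
  have bound : ∀ {m R : ℕ}, m ≤ K + 4 → R < 𝐒 (m - 4) → 𝐒 m + R < 𝐒 (K + 10 - 4) := by
    intro m R hm hR
    have : 𝐒 (m + 1) ≤ 𝐒 (K + 10 - 4) := S_mono (by omega)
    rw [S_succ] at this
    omega
  have hNk' := bound (by omega) hNk
  refine ⟨by omega, fun U hU => ⟨?_, ?_⟩⟩
  · rw [show U + N + 𝐒 k = U + (𝐒 k + N) by ring, hU.val_add hNk' (by omega),
      hU.val_add (by omega) (by omega), val_S_add hNk (by omega)]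
  · rw [show U + N + 𝐒 k + (𝐒 K + t') = U + (𝐒 i + v) by omega,
      show U + N + (𝐒 K + t') = U + (𝐒 M + u) by omega,
      hU.val_add (bound (by omega) hv) (by omega), hU.val_add (bound (by omega) hu') (by omega),
      val_S_add hv (by omega), val_S_add hu' (by omega)]
    obtain rfl | rfl := huv
    · exact val_five_succ_ne u
    · exact (val_five_succ_ne v).symm

/-! ### The topology of X and continuity of T -/

theorem isOpen_agree (k : ℕ) (x : ℕ → ℕ) : IsOpen {y : ℕ → ℕ | ∀ i < k, y i = x i} := by
  have : {y : ℕ → ℕ | ∀ i < k, y i = x i} = Set.pi (Set.Iio k) fun i => {x i} := by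
    ext y
    simp [Set.mem_pi]
  rw [this]
  exact isOpen_set_pi (Set.finite_Iio k) fun i _ => isOpen_discrete _

theorem exists_digits_eq (x : 𝐗) (k : ℕ) : ∃ n, ∀ i < k, 𝐃 n i = x.1 i := by
  obtain ⟨_, h, n, rfl⟩ := mem_closure_iff.1 x.2 _ (isOpen_agree k x.1) fun _ _ => rfl
  exact ⟨n, h⟩

theorem tendsto_of_forall_agree {α : Type*} {l : Filter α} {f : α → 𝐗} {x : 𝐗}
    (h : ∀ k, ∀ᶠ a in l, ∀ i < k, (f a).1 i = x.1 i) : Tendsto f l (𝓝 x) := by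
  rw [tendsto_subtype_rng, tendsto_pi_nhds]
  intro i
  rw [nhds_discrete, tendsto_pure]
  filter_upwards [h (i + 1)] with a ha using ha i (Nat.lt_succ_self i)

theorem eventually_agree (k : ℕ) (x : 𝐗) : ∀ᶠ y in 𝓝 x, ∀ i < k, y.1 i = x.1 i :=
  continuous_subtype_val.continuousAt.eventually ((isOpen_agree k x.1).mem_nhds fun _ _ => rfl)

theorem digits_succ_congr {k M N : ℕ} (h : ∀ i < k + 5, 𝐃 M i = 𝐃 N i) {i : ℕ} (hi : i < k) :
    𝐃 (M + 1) i = 𝐃 (N + 1) i :=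
  digits_eq_of_val_eq (val_succ_congr (val_congr h)) hi

/-- Digit i of y is read off from any integer that agrees with x in i + 6 digits; by
`digits_succ_congr` the choice is immaterial. This supplies the limit that defines T at x. -/
theorem exists_succ_point (x : 𝐗) : ∃ y : 𝐗, ∀ k n, (∀ i < k + 5, 𝐃 n i = x.1 i) →
    ∀ i < k, 𝐃 (n + 1) i = y.1 i := by
  choose a ha using fun k => exists_digits_eq x (k + 5)
  let y : ℕ → ℕ := fun i => 𝐃 (a (i + 1) + 1) i
  have key : ∀ k n, (∀ i < k + 5, 𝐃 n i = x.1 i) → ∀ i < k, 𝐃 (n + 1) i = y i := by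
    intro k n hn i hi
    exact digits_succ_congr (k := i + 1)
      (fun j hj => by rw [hn j (by omega), ha (i + 1) j hj]) (Nat.lt_succ_self i)
  refine ⟨⟨y, ?_⟩, key⟩
  refine mem_closure_of_tendsto (f := fun k => 𝐃 (a k + 1)) (b := atTop) ?_
    (Eventually.of_forall fun k => Set.mem_range_self _)
  rw [tendsto_pi_nhds]
  intro i
  rw [nhds_discrete, tendsto_pure]
  filter_upwards [eventually_gt_atTop i] with k hk using key k _ (ha k) i hk

instance comap_expansion_neBot (x : 𝐗) : (comap kneadingFive.expansion (𝓝 x)).NeBot := by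
  rw [comap_neBot_iff]
  intro t ht
  obtain ⟨u, hu, hut⟩ := mem_nhds_subtype _ _ _ |>.1 ht
  obtain ⟨_, h, n, rfl⟩ := mem_closure_iff_nhds.1 x.2 u hu
  exact ⟨n, hut h⟩

/-- The map `T` acts on points of `X` as the addition of one acts on nearby integers. -/
theorem T_apply {x : 𝐗} {k n : ℕ} (h : ∀ i < k + 5, 𝐃 n i = x.1 i) {i : ℕ} (hi : i < k) :
    (𝐓 x).1 i = 𝐃 (n + 1) i := by
  obtain ⟨y, hy⟩ := exists_succ_point x
  have hT : 𝐓 x = y := by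
    refine Tendsto.limUnder_eq (tendsto_of_forall_agree fun k => ?_)
    filter_upwards [(eventually_agree (k + 5) x).comap kneadingFive.expansion] with n hn
    exact hy k n hn
  rw [hT, hy k n h i hi]

theorem T_expansion (n : ℕ) : 𝐓 (kneadingFive.expansion n) = kneadingFive.expansion (n + 1) :=
  Subtype.ext (funext fun i => T_apply (k := i + 1) (fun _ _ => rfl) (Nat.lt_succ_self i))

theorem continuous_T : Continuous 𝐓 := by
  refine continuous_iff_continuousAt.2 fun x => tendsto_of_forall_agree fun k => ?_
  filter_upwards [eventually_agree (k + 5) x] with y hy i hi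
  obtain ⟨n, hn⟩ := exists_digits_eq x (k + 5)
  rw [T_apply hn hi, T_apply (fun j hj => by rw [hn j hj, hy j hj]) hi]

theorem T_iterate_apply {x : 𝐗} {n : ℕ} (t : ℕ) : ∀ {k : ℕ}, (∀ i < k + 5 * t, 𝐃 n i = x.1 i) →
    ∀ {i : ℕ}, i < k → (𝐓^[t] x).1 i = 𝐃 (n + t) i := by
  induction t with
  | zero => exact fun h i hi => (h i (by omega)).symm
  | succ t ih =>
    intro k h i hi
    rw [Function.iterate_succ_apply', ← add_assoc]
    exact T_apply (fun j hj => (ih (k := k + 5) (fun m hm => h m (by omega)) hj).symm) hi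

/-- Finitely many iterates of a point are shadowed by consecutive integers. -/
theorem exists_shadow (x : 𝐗) (k t : ℕ) : ∃ n, ∀ s ≤ t, ∀ i < k, (𝐓^[s] x).1 i = 𝐃 (n + s) i := by
  obtain ⟨n, hn⟩ := exists_digits_eq x (k + 5 * t)
  exact ⟨n, fun s hs i hi => T_iterate_apply s (fun j hj => hn j (by lia)) hi⟩

instance compactSpace_X : CompactSpace 𝐗 := by
  refine isCompact_iff_compactSpace.1 ?_
  have hK : IsCompact (Set.pi Set.univ fun _ : ℕ => Set.Iic (1 : ℕ)) :=
    isCompact_univ_pi fun _ => (Set.finite_Iic 1).isCompact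
  refine hK.of_isClosed_subset isClosed_closure (closure_minimal ?_ hK.isClosed)
  rintro _ ⟨n, rfl⟩ i -
  exact digits_le_one n i

/-! ### Cylinders and bounds for their measures -/

/-- The points of `X` whose lowest `k` digits are those of `n`. -/
def cyl (k n : ℕ) : Set 𝐗 := {x | val k x.1 = n}

theorem continuous_val (k : ℕ) : Continuous fun x : 𝐗 => val k x.1 := by
  exact continuous_finsetSum _ fun i _ =>
    ((continuous_apply i).comp continuous_subtype_val).mul continuous_const

theorem isOpen_cyl (k n : ℕ) : IsOpen (cyl k n) :=
  (isOpen_discrete {n}).preimage (continuous_val k)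

theorem measurableSet_cyl (k n : ℕ) : MeasurableSet (cyl k n) := (isOpen_cyl k n).measurableSet

theorem val_point_lt (k : ℕ) (x : 𝐗) : val k x.1 < 𝐒 k := by
  obtain ⟨n, hn⟩ := exists_digits_eq x k
  rw [← val_congr hn]
  exact val_lt k n

theorem digits_val_point {k i : ℕ} (x : 𝐗) (hi : i < k) : 𝐃 (val k x.1) i = x.1 i := by
  obtain ⟨n, hn⟩ := exists_digits_eq x k
  rw [← val_congr hn, digits_val k n hi, hn i hi]

theorem val_digits_val_point {j k : ℕ} (x : 𝐗) (hj : j ≤ k) :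
    val j (𝐃 (val k x.1)) = val j x.1 :=
  val_congr fun _ hi => digits_val_point x (by omega)

theorem val_T (K : ℕ) (x : 𝐗) : (val K (𝐓 x).1 = val K x.1 + 1) ∨
    (val K (𝐓 x).1 = 0 ∧ ∃ j, K - 4 ≤ j ∧ j ≤ K ∧ val K x.1 + 1 = 𝐒 j) := by
  obtain ⟨n, hn⟩ := exists_shadow x K 1
  have h₀ : val K x.1 = val K (𝐃 n) := val_congr (hn 0 (by omega))
  have h₁ : val K (𝐓 x).1 = val K (𝐃 (n + 1)) := val_congr (hn 1 le_rfl)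
  rw [h₀, h₁]
  exact val_succ K n

/-- A nonzero value n + 1 is reached only from n, which gives monotonicity by invariance. Equality
can fail only where part of the cylinder of n is reset to 0. -/
theorem measureReal_cyl_succ {μ : Measure 𝐗} (hμ : IsInvariantProbability 𝐓 μ) {K n : ℕ} :
    (n + 1 < 𝐒 K → (∀ j, K - 4 ≤ j → j ≤ K → n + 1 ≠ 𝐒 j) →
      μ.real (cyl K n) = μ.real (cyl K (n + 1))) ∧ μ.real (cyl K (n + 1)) ≤ μ.real (cyl K n) := by
  have := hμ.1
  have h₁ : μ.real (cyl K (n + 1)) = μ.real (𝐓 ⁻¹' cyl K (n + 1)) :=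
    (hμ.2.measureReal_preimage (measurableSet_cyl _ _).nullMeasurableSet).symm
  have h₂ : 𝐓 ⁻¹' cyl K (n + 1) ⊆ cyl K n := by
    intro x hx
    have hx' : val K (𝐓 x).1 = n + 1 := hx
    obtain h | h := val_T K x
    · exact show val K x.1 = n by omega
    · omega
  refine ⟨fun _ hn => le_antisymm ?_ ?_, ?_⟩
  · rw [h₁]
    refine measureReal_mono fun x hx => ?_
    have hx' : val K x.1 = n := hx
    obtain h | ⟨-, j, hj, hj', h⟩ := val_T K x
    · exact h.trans (by rw [hx'])
    · exact absurd (hx' ▸ h) (hn j hj hj')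
  all_goals
    rw [h₁]
    exact measureReal_mono h₂

theorem measureReal_eq_sum {μ : Measure 𝐗} [IsProbabilityMeasure μ] (K : ℕ) (P : ℕ → Prop)
    [DecidablePred P] : μ.real {x : 𝐗 | P (val K x.1)} =
      ∑ n ∈ Finset.range (𝐒 K), (if P n then 1 else 0) * μ.real (cyl K n) := by
  have h : {x : 𝐗 | P (val K x.1)} = ⋃ n ∈ (Finset.range (𝐒 K)).filter P, cyl K n := by
    ext x
    simp [cyl, val_point_lt]
  rw [h, measureReal_biUnion_finset ?_ fun n _ => measurableSet_cyl K n, Finset.sum_filter]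
  · exact Finset.sum_congr rfl fun n _ => by split_ifs <;> simp
  · intro i _ j _ hij
    exact Set.disjoint_left.2 fun x (hi : val K x.1 = i) (hj : val K x.1 = j) => hij (hi ▸ hj)

theorem sum_measureReal_cyl {μ : Measure 𝐗} [IsProbabilityMeasure μ] (K : ℕ) :
    ∑ n ∈ Finset.range (𝐒 K), μ.real (cyl K n) = 1 := by
  have := measureReal_eq_sum (μ := μ) K fun _ => True
  simpa using this.symm

/-- Summation by parts. -/
theorem sum_mul_nonpos {h c : ℕ → ℝ} {N : ℕ} (hc : 0 ≤ c N)
    (hN : ∑ n ∈ Finset.range (N + 1), h n ≤ 0)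
    (hstep : ∀ n < N, c n = c (n + 1) ∨
      (c (n + 1) ≤ c n ∧ ∑ i ∈ Finset.range (n + 1), h i ≤ 0)) :
    ∑ n ∈ Finset.range (N + 1), h n * c n ≤ 0 := by
  have key : ∀ M, ∑ n ∈ Finset.range (M + 1), h n * c n =
      (∑ n ∈ Finset.range (M + 1), h n) * c M +
        ∑ n ∈ Finset.range M, (∑ i ∈ Finset.range (n + 1), h i) * (c n - c (n + 1)) := by
    intro M
    induction M with
    | zero => simp
    | succ M ih =>
      rw [Finset.sum_range_succ, ih, Finset.sum_range_succ h (M + 1),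
        Finset.sum_range_succ (fun n => (∑ i ∈ Finset.range (n + 1), h i) * (c n - c (n + 1)))]
      ring
  rw [key]
  refine add_nonpos (mul_nonpos_of_nonpos_of_nonneg hN hc) (Finset.sum_nonpos fun n hn => ?_)
  obtain h' | ⟨h₁, h₂⟩ := hstep n (Finset.mem_range.1 hn)
  · simp [h']
  · exact mul_nonpos_of_nonpos_of_nonneg h₂ (sub_nonneg.2 h₁)

/-- The number of `n < 𝐒 j` whose lowest `k` digits are those of `w`. -/
def count (k w j : ℕ) : ℝ := ∑ n ∈ Finset.range (𝐒 j), if val k (𝐃 n) = w then 1 else 0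

theorem count_succ {k w j : ℕ} (hj : k ≤ j) :
    count k w (j + 1) = count k w j + count k w (j - 4) := by
  unfold count
  rw [S_succ, Finset.sum_range_add]
  congr 1
  exact Finset.sum_congr rfl fun R hR => by rw [val_S_add (Finset.mem_range.1 hR) hj]

/-- The weights are nonincreasing and drop only at n + 1 = S j with K - 4 ≤ j ≤ K, so summation by
parts uses only the partial sums of h up to such S j. -/
theorem sum_sub_mul_nonpos {μ : Measure 𝐗} (hμ : IsInvariantProbability 𝐓 μ) {K : ℕ} {h : ℕ → ℝ}
    (hK : ∀ j, K - 4 ≤ j → j ≤ K → ∑ n ∈ Finset.range (𝐒 j), h n ≤ 0) :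
    ∑ n ∈ Finset.range (𝐒 K), h n * μ.real (cyl K n) ≤ 0 := by
  have hpos := S_pos K
  obtain ⟨N, hN⟩ := Nat.exists_eq_add_of_le' (Nat.succ_le_of_lt hpos)
  rw [Nat.succ_eq_add_one, zero_add] at hN
  have hKK := hK K (by omega) le_rfl
  rw [hN] at hKK ⊢
  refine sum_mul_nonpos measureReal_nonneg hKK fun n hn => ?_
  obtain ⟨h₁, h₂⟩ := measureReal_cyl_succ hμ (K := K) (n := n)
  by_cases hex : ∃ j, K - 4 ≤ j ∧ j ≤ K ∧ n + 1 = 𝐒 j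
  · obtain ⟨j, hj, hj', hnj⟩ := hex
    exact .inr ⟨h₂, hnj ▸ hK j hj hj'⟩
  · exact .inl (h₁ (by omega) fun j hj hj' e => hex ⟨j, hj, hj', e⟩)

/-- Bounds for the frequency of a cylinder along cutting times bound its measure. -/
theorem measureReal_cyl_mem_Icc {μ : Measure 𝐗} (hμ : IsInvariantProbability 𝐓 μ) {k w K : ℕ}
    (hk : k ≤ K) {m M : ℝ}
    (h : ∀ j, K - 4 ≤ j → j ≤ K → m * 𝐒 j ≤ count k w j ∧ count k w j ≤ M * 𝐒 j) :
    m ≤ μ.real (cyl k w) ∧ μ.real (cyl k w) ≤ M := by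
  have := hμ.1
  have hsum : μ.real (cyl k w) = ∑ n ∈ Finset.range (𝐒 K),
      (if val k (𝐃 n) = w then 1 else 0) * μ.real (cyl K n) := by
    rw [← measureReal_eq_sum K fun n => val k (𝐃 n) = w]
    simp only [val_digits_val_point _ hk]
    rfl
  have hone := sum_measureReal_cyl (μ := μ) K
  constructor
  · have := sum_sub_mul_nonpos hμ (K := K) (h := fun n => m - if val k (𝐃 n) = w then 1 else 0)
      fun j hj hj' => by
        have := (h j hj hj').1
        unfold count at this
        rw [Finset.sum_sub_distrib]
        simp only [Finset.sum_const, Finset.card_range, nsmul_eq_mul]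
        linarith
    simp only [sub_mul, Finset.sum_sub_distrib, ← Finset.mul_sum, hone] at this
    linarith
  · have := sum_sub_mul_nonpos hμ (K := K) (h := fun n => (if val k (𝐃 n) = w then 1 else 0) - M)
      fun j hj hj' => by
        have := (h j hj hj').2
        unfold count at this
        rw [Finset.sum_sub_distrib]
        simp only [Finset.sum_const, Finset.card_range, nsmul_eq_mul]
        linarith
    simp only [sub_mul, Finset.sum_sub_distrib, ← Finset.mul_sum, hone] at this
    linarith

/-! ### Quotients of solutions of the recursion -/

/-- Two solutions of `a (i + 5) = a (i + 4) + a i`, of which one is positive: an upper bound for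
their quotient on five consecutive indices improves on the next five. -/
theorem recurrence_upper {F s : ℕ → ℝ} (hF : ∀ i, F (i + 5) = F (i + 4) + F i)
    (hs : ∀ i, s (i + 5) = s (i + 4) + s i) (hpos : ∀ i, 0 < s i) (h2 : ∀ i, s (i + 1) ≤ 2 * s i)
    {M r : ℝ} (hM : ∀ i < 5, F i ≤ M * s i) (hr : F 4 = r * s 4) :
    ∀ i < 5, F (i + 5) ≤ (M - (M - r) / 32) * s (i + 5) := by
  have hrM : 0 ≤ M - r := by
    have := hM 4 (by norm_num)
    rw [hr] at this
    exact sub_nonneg.2 (le_of_mul_le_mul_right this (hpos 4))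
  -- Each new quotient F / s is a weighted mean of the previous one and an earlier one that is at
  -- most M. The previous one has weight at least 1/2 by `h2`, so the gap below M shrinks at most by
  -- half per step.
  have key : ∀ i ≤ 5, F (i + 4) ≤ (M - (M - r) / 2 ^ i) * s (i + 4) := by
    intro i hi
    induction i with
    | zero => simp [hr]
    | succ i ih =>
      have h₁ := ih (by omega)
      have h₂ := hM i (by omega)
      have h₃ := mul_le_mul_of_nonneg_left (h2 (i + 4))
        (show 0 ≤ (M - r) / 2 ^ (i + 1) by positivity)
      rw [show i + 4 + 1 = i + 5 by ring] at h₃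
      have h₄ : (M - r) / 2 ^ (i + 1) * (2 * s (i + 4)) = (M - r) / 2 ^ i * s (i + 4) := by
        rw [pow_succ]
        field_simp
      have h₅ := hs i
      rw [show i + 1 + 4 = i + 5 by ring, hF, sub_mul]
      rw [h₄] at h₃
      rw [h₅] at h₃ ⊢
      linarith
  intro i hi
  have h₁ := key (i + 1) (by omega)
  rw [show i + 1 + 4 = i + 5 by ring] at h₁
  refine h₁.trans (mul_le_mul_of_nonneg_right ?_ (hpos _).le)
  have : (M - r) / 32 ≤ (M - r) / 2 ^ (i + 1) := by
    have : (2 : ℝ) ^ (i + 1) ≤ 2 ^ 5 := pow_le_pow_right₀ (by norm_num) (by omega)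
    have h32 : (2 : ℝ) ^ 5 = 32 := by norm_num
    exact div_le_div_of_nonneg_left hrM (by positivity) (h32 ▸ this)
  linarith

/-- The quotients of two such solutions are asymptotically constant. -/
theorem recurrence_bounds {F s : ℕ → ℝ} (hF : ∀ i, F (i + 5) = F (i + 4) + F i)
    (hs : ∀ i, s (i + 5) = s (i + 4) + s i) (hpos : ∀ i, 0 < s i) (h2 : ∀ i, s (i + 1) ≤ 2 * s i)
    {m M : ℝ} (hm : ∀ i < 5, m * s i ≤ F i) (hM : ∀ i < 5, F i ≤ M * s i) (n : ℕ) :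
    ∃ m' M', M' - m' = (31 / 32) ^ n * (M - m) ∧
      ∀ i < 5, m' * s (i + 5 * n) ≤ F (i + 5 * n) ∧ F (i + 5 * n) ≤ M' * s (i + 5 * n) := by
  induction n with
  | zero => exact ⟨m, M, by simp, fun i hi => ⟨hm i hi, hM i hi⟩⟩
  | succ n ih =>
    obtain ⟨m', M', hd, h⟩ := ih
    have shift : ∀ {a : ℕ → ℝ}, (∀ i, a (i + 5) = a (i + 4) + a i) →
        ∀ i, a (i + 5 + 5 * n) = a (i + 4 + 5 * n) + a (i + 5 * n) := fun ha i => by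
      rw [show i + 5 + 5 * n = i + 5 * n + 5 by ring, ha]
      congr 2
      ring
    have h2' : ∀ i, s (i + 1 + 5 * n) ≤ 2 * s (i + 5 * n) := fun i => by
      rw [show i + 1 + 5 * n = i + 5 * n + 1 by ring]
      exact h2 _
    obtain ⟨r, hr⟩ : ∃ r, F (4 + 5 * n) = r * s (4 + 5 * n) :=
      ⟨F (4 + 5 * n) / s (4 + 5 * n), (div_mul_cancel₀ _ (hpos _).ne').symm⟩
    have hU := recurrence_upper (F := fun i => F (i + 5 * n)) (s := fun i => s (i + 5 * n))
      (shift hF) (shift hs) (fun i => hpos _) h2' (fun i hi => (h i hi).2) hr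
    -- Applied to -F, the upper bound becomes a lower one. The gains (M' - r) / 32 and (r - m') / 32
    -- add up to (M' - m') / 32 whatever r is.
    have hL := recurrence_upper (F := fun i => -F (i + 5 * n)) (s := fun i => s (i + 5 * n))
      (M := -m') (r := -r) (fun i => by rw [shift hF]; ring) (shift hs) (fun i => hpos _) h2'
      (fun i hi => by linarith [(h i hi).1]) (by rw [hr]; ring)
    refine ⟨m' + (r - m') / 32, M' - (M' - r) / 32, ?_, fun i hi => ?_⟩
    · rw [pow_succ]
      linarith
    · have h₁ := hU i hi
      have h₂ := hL i hi
      rw [show i + 5 * (n + 1) = i + 5 + 5 * n by ring]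
      refine ⟨?_, h₁⟩
      linarith

/-! ### Uniqueness of the invariant measure -/

/-- From index k on, `count k w` satisfies the recursion of the cutting times, so both measures lie
in a common interval of length (31 / 32) ^ n for every n. -/
theorem measureReal_cyl_eq {μ ν : Measure 𝐗} (hμ : IsInvariantProbability 𝐓 μ)
    (hν : IsInvariantProbability 𝐓 ν) (k w : ℕ) : μ.real (cyl k w) = ν.real (cyl k w) := by
  have hcount : ∀ j, 0 ≤ count k w j ∧ count k w j ≤ 𝐒 j := fun j => by
    unfold count
    constructor
    · exact Finset.sum_nonneg fun n _ => by split_ifs <;> simp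
    · refine (Finset.sum_le_card_nsmul _ _ 1 fun n _ => by split_ifs <;> simp).trans ?_
      simp
  have hb := recurrence_bounds (F := fun i => count k w (i + k)) (s := fun i => (𝐒 (i + k) : ℝ))
    (fun i => by
      rw [show i + 5 + k = i + 4 + k + 1 by ring, count_succ (by omega)]
      congr 2
      omega)
    (fun i => by
      rw [show i + 5 + k = i + 4 + k + 1 by ring, S_succ, show i + 4 + k - 4 = i + k by omega]
      push_cast
      rfl)
    (fun i => by exact_mod_cast S_pos _)
    (fun i => by
      rw [show i + 1 + k = i + k + 1 by ring]
      exact_mod_cast S_succ_le_two_mul _)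
    (m := 0) (M := 1) (fun i _ => by simpa using (hcount _).1)
    (fun i _ => by simpa using (hcount _).2)
  have hle : ∀ n : ℕ, |μ.real (cyl k w) - ν.real (cyl k w)| ≤ (31 / 32 : ℝ) ^ n := by
    intro n
    obtain ⟨m, M, hd, h⟩ := hb n
    have h' : ∀ j, 4 + 5 * n + k - 4 ≤ j → j ≤ 4 + 5 * n + k →
        m * 𝐒 j ≤ count k w j ∧ count k w j ≤ M * 𝐒 j := fun j hj hj' => by
      have := h (j - (5 * n + k)) (by omega)
      rwa [show j - (5 * n + k) + 5 * n + k = j by omega] at this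
    have h₁ := measureReal_cyl_mem_Icc hμ (by omega) h'
    have h₂ := measureReal_cyl_mem_Icc hν (by omega) h'
    rw [abs_le]
    constructor <;> linarith
  have hlim := tendsto_pow_atTop_nhds_zero_of_lt_one (r := (31 / 32 : ℝ)) (by norm_num) (by norm_num)
  have := ge_of_tendsto' hlim hle
  exact sub_eq_zero.1 (abs_nonpos_iff.1 this)

theorem isTopologicalBasis_cyl :
    TopologicalSpace.IsTopologicalBasis {A : Set 𝐗 | ∃ k w, A = cyl k w} := by
  refine TopologicalSpace.isTopologicalBasis_of_isOpen_of_nhds ?_ ?_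
  · rintro _ ⟨k, w, rfl⟩
    exact isOpen_cyl k w
  · intro x U hx hU
    by_contra! hcon
    have hne : ∀ k, ∃ y ∈ cyl k (val k x.1), y ∉ U := fun k =>
      Set.not_subset.1 (hcon _ ⟨k, _, rfl⟩ rfl)
    choose y hy hyU using hne
    have hlim : Tendsto y atTop (𝓝 x) := tendsto_of_forall_agree fun k => by
      filter_upwards [eventually_ge_atTop k] with n hn i hi
      have : val n (y n).1 = val n x.1 := hy n
      rw [← digits_val_point (y n) (hi.trans_le hn), this, digits_val_point x (hi.trans_le hn)]
    obtain ⟨n, hn⟩ := (hlim.eventually (hU.mem_nhds hx)).exists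
    exact hyU n hn

theorem isPiSystem_cyl : IsPiSystem {A : Set 𝐗 | ∃ k w, A = cyl k w} := by
  have aux : ∀ {j k : ℕ} {v w : ℕ}, j ≤ k → (cyl j v ∩ cyl k w).Nonempty →
      cyl j v ∩ cyl k w = cyl k w := by
    rintro j k v w hjk ⟨x, hx, hx'⟩
    refine Set.inter_eq_right.2 fun y hy => ?_
    have h₁ : val k y.1 = val k x.1 := Eq.trans hy hx'.symm
    exact show val j y.1 = v by
      rw [← val_digits_val_point y hjk, h₁, val_digits_val_point x hjk]
      exact hx
  rintro _ ⟨j, v, rfl⟩ _ ⟨k, w, rfl⟩ hne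
  obtain h | h := le_total j k
  · exact ⟨k, w, aux h hne⟩
  · exact ⟨j, v, by
      rw [Set.inter_comm] at hne ⊢
      exact aux h hne⟩

theorem invariantProbability_unique {μ ν : Measure 𝐗} (hμ : IsInvariantProbability 𝐓 μ)
    (hν : IsInvariantProbability 𝐓 ν) : ν = μ := by
  have := hμ.1
  have := hν.1
  refine ext_of_generate_finite _ ?_ isPiSystem_cyl ?_ (by simp)
  · rw [← isTopologicalBasis_cyl.borel_eq_generateFrom]
    exact BorelSpace.measurable_eq
  · rintro _ ⟨k, w, rfl⟩
    exact (measureReal_eq_measureReal_iff).1 (measureReal_cyl_eq hν hμ k w)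

/-! ### Failure of rigidity -/

/-- The set of points that return to their lowest five digits after time `t`. -/
def returning (t : ℕ) : Set 𝐗 := {x | val 5 (𝐓^[t] x).1 = val 5 x.1}

theorem measurableSet_returning (t : ℕ) : MeasurableSet (returning t) :=
  (isClosed_eq ((continuous_val 5).comp (continuous_T.iterate t)) (continuous_val 5)).measurableSet

theorem measureReal_cyl_eq_zero_cyl {μ : Measure 𝐗} (hμ : IsInvariantProbability 𝐓 μ) {K n : ℕ}
    (hn : n < 𝐒 (K - 4)) : μ.real (cyl K n) = μ.real (cyl K 0) := by
  induction n with
  | zero => rfl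
  | succ n ih =>
    rw [← ih (by omega)]
    have h := S_mono (Nat.sub_le K 4)
    refine ((measureReal_cyl_succ hμ).1 (by omega) fun j hj _ => ?_).symm
    have := S_mono hj
    omega

/-- The cylinder of 0 is the largest of S K cylinders whose measures sum to 1. -/
theorem one_le_S_mul_measureReal_cyl {μ : Measure 𝐗} (hμ : IsInvariantProbability 𝐓 μ) (K : ℕ) :
    1 ≤ 𝐒 K * μ.real (cyl K 0) := by
  have := hμ.1
  have hanti : Antitone fun n => μ.real (cyl K n) :=
    antitone_nat_of_succ_le fun n => (measureReal_cyl_succ hμ).2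
  rw [← sum_measureReal_cyl (μ := μ) K]
  refine (Finset.sum_le_card_nsmul _ _ _ fun n _ => hanti (Nat.zero_le n)).trans ?_
  simp

theorem measureReal_compl_returning {μ : Measure 𝐗} (hμ : IsInvariantProbability 𝐓 μ) {t : ℕ}
    (ht : 𝐒 20 ≤ t) : 1 / 2 ^ 26 ≤ μ.real (returning t)ᶜ := by
  have := hμ.1
  obtain ⟨K, a, s, hK, h⟩ := exists_distinguishing_shift ht
  let G : Set 𝐗 := ⋃ n ∈ Finset.Ico a (a + 𝐒 (K - 15)), cyl (K + 10) n
  -- If x and T^s x both returned after time t, the lowest five digits would agree at times 0, t, s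
  -- and s + t, whereas the shift s changes those at time t.
  have hG : G ⊆ (returning t)ᶜ ∪ 𝐓^[s] ⁻¹' (returning t)ᶜ := by
    intro x hx
    simp only [G, Set.mem_iUnion, Finset.mem_Ico] at hx
    obtain ⟨N, ⟨hN, hN'⟩, hxN⟩ := hx
    replace hxN : val (K + 10) x.1 = N := hxN
    obtain ⟨n, hn⟩ := exists_shadow x (K + 10) (s + t)
    have hval : ∀ i ≤ s + t, val 5 (𝐓^[i] x).1 = val 5 (𝐃 (n + i)) :=
      fun i hi => val_congr fun j hj => hn i hi j (by omega)
    obtain ⟨U, hU, hnU⟩ := exists_lowZero_add_val (K + 10) n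
    have hnN : val (K + 10) x.1 = val (K + 10) (𝐃 n) := val_congr (hn 0 (by omega))
    rw [← hnN, hxN] at hnU
    obtain ⟨h₁, h₂⟩ := (h N hN hN').2 U hU
    rw [← hnU] at h₁ h₂
    by_contra hcon
    simp only [Set.mem_union, Set.mem_compl_iff, Set.mem_preimage, not_or, not_not, returning,
      Set.mem_ofPred_eq, ← Function.iterate_add_apply] at hcon
    rw [add_comm t s, hval _ le_rfl, hval s (by omega), hval t (by omega)] at hcon
    have h₀ := hval 0 (by omega)
    rw [Function.iterate_zero_apply] at h₀
    rw [h₀, ← add_assoc] at hcon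
    apply h₂
    rw [hcon.2, h₁, hcon.1]
    rfl
  have hμG : μ.real G = 𝐒 (K - 15) * μ.real (cyl (K + 10) 0) := by
    rw [measureReal_biUnion_finset ?_ fun n _ => measurableSet_cyl _ n]
    · rw [Finset.sum_congr rfl fun n hn => measureReal_cyl_eq_zero_cyl hμ
        (h n (Finset.mem_Ico.1 hn).1 (Finset.mem_Ico.1 hn).2).1]
      simp
    · intro i _ j _ hij
      exact Set.disjoint_left.2 fun x (hi : val _ x.1 = i) (hj : val _ x.1 = j) => hij (hi ▸ hj)
  have hpre : μ.real (𝐓^[s] ⁻¹' (returning t)ᶜ) = μ.real (returning t)ᶜ :=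
    (hμ.2.iterate s).measureReal_preimage (measurableSet_returning t).compl.nullMeasurableSet
  have hle : μ.real G ≤ 2 * μ.real (returning t)ᶜ := by
    refine (measureReal_mono hG).trans ((measureReal_union_le _ _).trans ?_)
    rw [hpre, two_mul]
  have hgrow : ∀ j i, 𝐒 (j + i) ≤ 2 ^ i * 𝐒 j := by
    intro j i
    induction i with
    | zero => simp
    | succ i ih =>
      have := S_succ_le_two_mul (j + i)
      rw [pow_succ, ← add_assoc]
      linarith
  -- There are 25 steps from K - 15 to K + 10, each at most doubling; the remaining factor 2 of 2 ^
  -- 26 comes from `hle`.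
  have hS : (𝐒 (K + 10) : ℝ) ≤ 2 ^ 25 * 𝐒 (K - 15) := by
    have := hgrow (K - 15) 25
    rw [show K - 15 + 25 = K + 10 by omega] at this
    exact_mod_cast this
  have h₁ := one_le_S_mul_measureReal_cyl hμ (K + 10)
  have h₂ := mul_le_mul_of_nonneg_right hS (measureReal_nonneg (μ := μ) (s := cyl (K + 10) 0))
  rw [mul_assoc, ← hμG] at h₂
  rw [div_le_iff₀ (by positivity)]
  linarith

theorem not_isMeasureRigid {μ : Measure 𝐗} (hμ : IsInvariantProbability 𝐓 μ) :
    ¬ IsMeasureRigid 𝐓 μ := by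
  rintro ⟨t, ht, hrigid⟩
  have := hμ.1
  have hlim : Tendsto (fun n => ∑ w ∈ Finset.range (𝐒 5),
      μ.real (symmDiff (𝐓^[t n] ⁻¹' cyl 5 w) (cyl 5 w))) atTop (𝓝 0) := by
    rw [← Finset.sum_const_zero (s := Finset.range (𝐒 5))]
    refine tendsto_finsetSum _ fun w _ => ?_
    exact (ENNReal.tendsto_toReal ENNReal.zero_ne_top).comp (hrigid _ (measurableSet_cyl 5 w))
  have hle : ∀ᶠ n in atTop, (1 / 2 ^ 26 : ℝ) ≤ ∑ w ∈ Finset.range (𝐒 5),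
      μ.real (symmDiff (𝐓^[t n] ⁻¹' cyl 5 w) (cyl 5 w)) := by
    filter_upwards [ht.eventually_ge_atTop (𝐒 20)] with n hn
    refine (measureReal_compl_returning hμ hn).trans ?_
    refine (measureReal_mono ?_ (measure_ne_top _ _)).trans (measureReal_biUnion_finset_le _ _)
    intro x hx
    simp only [Set.mem_iUnion, Finset.mem_range]
    -- A point that does not return leaves its own five-digit cylinder, hence lies in that symmetric
    -- difference.
    exact ⟨val 5 x.1, val_point_lt 5 x, .inr ⟨rfl, hx⟩⟩
  have := ge_of_tendsto hlim hle
  norm_num at this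

end KneadingFive

theorem mainTheorem5 :
    Continuous kneadingFive.T ∧
    (∀ n : ℕ, kneadingFive.T (kneadingFive.expansion n) = kneadingFive.expansion (n + 1)) ∧
    ∃ μ : Measure kneadingFive.X,
      IsInvariantProbability kneadingFive.T μ ∧
      (∀ ν : Measure kneadingFive.X, IsInvariantProbability kneadingFive.T ν → ν = μ) ∧
      ¬ IsMeasureRigid kneadingFive.T μ := by
  obtain ⟨μ, hμ⟩ := exists_isInvariantProbability KneadingFive.continuous_T
  exact ⟨KneadingFive.continuous_T, KneadingFive.T_expansion, μ, hμ,
    fun ν hν => KneadingFive.invariantProbability_unique hμ hν, KneadingFive.not_isMeasureRigid hμ⟩
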